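/- Let $\Gamma$ be a weighted digraph without loops on the vertex set $\{1,\dots,n\}$, $n>1$, with weight $w_{ij}>0$ on each arc $(i,j)$ and $w_{ij}=0$ if there is no arc $(i,j)$. Its column Laplacian matrix $L=(\ell_{ij})$ is given by $\ell_{ij}=-w_{ij}$ for $i\ne j$ and $\ell_{ii}=\sum_{k\ne i}w_{ki}$. A diverging tree is a weakly connected digraph in which one vertex (the root) has indegree $0$ and all other vertices have indegree $1$. An out-forest of $\Gamma$ is a spanning subgraph all of whose weak components are diverging trees, and its weight is the product of the weights of its arcs (the empty product being $1$). Let $d'$ be the minimum possible number of trees in an out-forest of $\Gamma$; the maximum out-forests of $\Gamma$ are those with $n-d'$ arcs. Let $\sigma_{n-d'}$ be the total weight of all maximum out-forests, and let $\bar J=(\bar J_{ij})$ be the $n\times n$ matrix in which $\bar J_{ij}$ is $\sigma_{n-d'}^{-1}$ times the total weight of those maximum out-forests in which $j$ belongs to a tree with root $i$. Let a homogeneous Markov chain on $\{1,\dots,n\}$ with transition probability matrix $P$ (where $P_{ij}$ is the probability of transition from $i$ to $j$) inversely correspond to $\Gamma$, that is, $I-P=\alpha L^{T}$ for some nonzero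 real number $\alpha$. Suppose that the initial state distribution is uniform. Then $$x=\frac1n\,\bar J\cdot(1,\dots,1)^{T}$$ is the limiting state distribution of the chain in the sense of Cesàro: $x$ is a probability vector and, if $p^{(k)}=\bigl(\tfrac1n,\dots,\tfrac1n\bigr)P^{k}$ is the state distribution at time $k$ (the law of the state at time $k$), then $$\lim_{N\to\infty}\frac1N\sum_{k=0}^{N-1}p^{(k)}_i=x_i\qquad(i=1,\dots,n).$$ -/

import Mathlib

open Filter Topology

/-- A weighted digraph without loops (and without parallel arcs) on the vertex set `Fin n`:
`weight i j` is the weight of the arc `(i, j)`, and it is zero exactly when there is no such arc. -/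
structure WeightedDigraph (n : ℕ) where
  /-- The matrix of arc weights. -/
  weight : Matrix (Fin n) (Fin n) ℝ
  weight_nonneg : ∀ i j, 0 ≤ weight i j
  weight_self : ∀ i, weight i i = 0

namespace ArcSet

variable {n : ℕ}

/-- The number of arcs of `F` that come in `v`. -/
def indegree (F : Finset (Fin n × Fin n)) (v : Fin n) : ℕ :=
  (F.filter (fun a => a.2 = v)).card

/-- `u` and `v` lie in the same weak component of the digraph on `Fin n` with arc set `F`,
that is, they are equal or joined by a semiroute. -/
def WeaklyConnected (F : Finset (Fin n × Fin n)) (u v : Fin n) : Prop :=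
  Relation.EqvGen (fun a b => (a, b) ∈ F) u v

/-- Every weak component of the digraph on `Fin n` with arc set `F` is a diverging tree: one of
its vertices (the root) has indegree zero and all its other vertices have indegree one. All arcs
that come in a vertex belong to the weak component of this vertex, so the indegrees in the
component are those in `F`. -/
def IsDivergingForest (F : Finset (Fin n × Fin n)) : Prop :=
  ∀ v, ∃ r, WeaklyConnected F v r ∧ indegree F r = 0 ∧
    ∀ u, WeaklyConnected F v u → u ≠ r → indegree F u = 1

/-- The vertices of indegree zero; in a diverging forest, each tree contains exactly one. -/
def roots (F : Finset (Fin n × Fin n)) : Finset (Fin n) :=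
  Finset.univ.filter (fun v => indegree F v = 0)

end ArcSet

namespace WeightedDigraph

variable {n : ℕ} (G : WeightedDigraph n)

open Classical in
/-- The set of arcs. -/
noncomputable def arcs : Finset (Fin n × Fin n) :=
  Finset.univ.filter (fun a => 0 < G.weight a.1 a.2)

open Classical in
/-- The out-forests of `G`, i.e. its spanning diverging forests, given by their arc sets. -/
noncomputable def outForests : Finset (Finset (Fin n × Fin n)) :=
  G.arcs.powerset.filter ArcSet.IsDivergingForest

/-- The weight of a spanning subgraph: the product of the weights of its arcs. -/
noncomputable def subgraphWeight (F : Finset (Fin n × Fin n)) : ℝ :=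
  ∏ a ∈ F, G.weight a.1 a.2

/-- The out-forests with `k` arcs. -/
noncomputable def outForestsWith (k : ℕ) : Finset (Finset (Fin n × Fin n)) :=
  G.outForests.filter (fun F => F.card = k)

open Classical in
/-- The out-forests with `k` arcs where `j` belongs to a tree diverging from `i`. -/
noncomputable def outForestsFromTo (k : ℕ) (i j : Fin n) : Finset (Finset (Fin n × Fin n)) :=
  (G.outForestsWith k).filter (fun F => i ∈ ArcSet.roots F ∧ ArcSet.WeaklyConnected F i j)

/-- The total weight `σ_k` of the out-forests with `k` arcs. -/
noncomputable def sigma (k : ℕ) : ℝ :=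
  ∑ F ∈ G.outForestsWith k, G.subgraphWeight F

/-- The matrix `Q_k` of out-forests with `k` arcs. -/
noncomputable def forestMatrix (k : ℕ) : Matrix (Fin n) (Fin n) ℝ :=
  Matrix.of fun i j => ∑ F ∈ G.outForestsFromTo k i j, G.subgraphWeight F

/-- The normalized matrix `J_k` of out-forests with `k` arcs. -/
noncomputable def normalizedForestMatrix (k : ℕ) : Matrix (Fin n) (Fin n) ℝ :=
  (G.sigma k)⁻¹ • G.forestMatrix k

/-- The out-forest dimension: the minimum possible number of diverging trees (counted by their
roots) in an out-forest. -/
noncomputable def outForestDim : ℕ :=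
  sInf {d | ∃ F ∈ G.outForests, (ArcSet.roots F).card = d}

/-- The normalized matrix of maximum out-forests. -/
noncomputable def maxForestMatrix : Matrix (Fin n) (Fin n) ℝ :=
  G.normalizedForestMatrix (n - G.outForestDim)

/-- The column Laplacian matrix. -/
noncomputable def laplacian : Matrix (Fin n) (Fin n) ℝ :=
  Matrix.of fun i j =>
    if i = j then ∑ k ∈ Finset.univ.erase i, G.weight k i else -G.weight i j

/-- The digraph `G` and a finite homogeneous Markov chain with transition matrix `P`
inversely correspond to each other. -/
def InverselyCorresponds (P : Matrix (Fin n) (Fin n) ℝ) : Prop :=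
  ∃ α : ℝ, α ≠ 0 ∧ 1 - P = α • G.laplacian.transpose

end WeightedDigraph

namespace MarkovChain

variable {n : ℕ}

/-- The process `X` is a homogeneous Markov chain on `Fin n` with transition matrix `P`; the entry
`P i j` is the probability of transition from `i` to `j`. -/
structure IsChain {Ω : Type*} [MeasurableSpace Ω] (μ : MeasureTheory.Measure Ω)
    (P : Matrix (Fin n) (Fin n) ℝ) (X : ℕ → Ω → Fin n) : Prop where
  isProbabilityMeasure : MeasureTheory.IsProbabilityMeasure μ
  measurable : ∀ k, Measurable (X k)
  stochastic : P ∈ Matrix.rowStochastic ℝ (Fin n)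
  markov : ∀ (k : ℕ) (s : ℕ → Fin n),
    μ.real {ω | ∀ m ≤ k + 1, X m ω = s m} =
      μ.real {ω | ∀ m ≤ k, X m ω = s m} * P (s k) (s (k + 1))

/-- The uniform distribution on `Fin n`. -/
noncomputable def uniform (n : ℕ) : Fin n → ℝ := fun _ => 1 / (n : ℝ)

/-- The state distribution at time `k` of the chain with transition matrix `P` and initial
distribution `p`. -/
noncomputable def stateDistribution (P : Matrix (Fin n) (Fin n) ℝ) (p : Fin n → ℝ) (k : ℕ) :
    Fin n → ℝ :=
  Matrix.vecMul p (P ^ k)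

/-- `x` is the (Cesàro) limiting distribution of the sequence `p` of state distributions. -/
def IsLimitingDistribution (p : ℕ → Fin n → ℝ) (x : Fin n → ℝ) : Prop :=
  x ∈ stdSimplex ℝ (Fin n) ∧
    Tendsto (fun N : ℕ => (1 / (N : ℝ)) • ∑ k ∈ Finset.range N, p k) atTop (𝓝 x)

end MarkovChain

/-!
Write `Q k` for `G.forestMatrix k`, `σ k` for `G.sigma k` and `L` for the Laplacian. The heart of
the proof is the recurrence `Q (k + 1) + Q k * L = σ (k + 1) • 1`
(`WeightedDigraph.forestMatrix_succ_add`), proved combinatorially one column `j` at a time. Every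
diverging forest either has `j` as a root, or arises in exactly one way from a forest `D` rooted
at `j` (among others) by adding an arc `(l, j)` from a vertex `l` of another tree
(`ArcSet.sum_forests_eq`). The entry `(i, j)` of `Q k * L` is a sum over forests `F` and arcs
`(l, j)` of the difference between the indicators of "`j` is in the tree of `i`" and "`l` is in
the tree of `i`". The forests obtained by hanging the tree of `j` on some `m` contribute a double
sum over `m` and `l` that is antisymmetric, hence zero (`WeightedDigraph.sum_hang_cancel`). For
the forests in which `j` is a root, adding the arc `(l, j)` gives the forests with `k + 1` arcs in
which `j` is not a root, and these account for `σ (k + 1) • 1 - Q (k + 1)`.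

For `m = n - d'` there are no forests with `m + 1` arcs, because the arcs and the roots of a
forest together number `n`; and `σ m > 0`. The recurrence thus yields `J * L = 0` and
`J + M * L = 1` for the normalized matrix `J` of maximum out-forests and some matrix `M`.
Transposed, and with `1 - P = α • Lᵀ`, this says `P * Jᵀ = Jᵀ` and `Jᵀ + (1 - P) * K = 1`. Hence
`p P ^ k = p Jᵀ + p P ^ k (1 - P) K`, where the second terms telescope and are bounded in sum, so
the averages converge to `p Jᵀ` (`MarkovChain.tendsto_average_stateDistribution`). The limit is a
probability vector because the simplex is closed and convex. Finally, summing the path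
probabilities of a chain over the past shows that its law at time `k` is `p P ^ k`
(`MarkovChain.IsChain.law_eq_stateDistribution`).
-/

/-! ### Diverging forests -/

namespace ArcSet

variable {n : ℕ}

/-- `v` can be reached from `u` along a directed path of `F` (possibly of length zero). -/
def Reaches (F : Finset (Fin n × Fin n)) (u v : Fin n) : Prop :=
  Relation.ReflTransGen (fun a b => (a, b) ∈ F) u v

theorem indegree_eq_zero {F : Finset (Fin n × Fin n)} {v : Fin n} :
    indegree F v = 0 ↔ ∀ a, (a, v) ∉ F := by
  unfold indegree
  rw [Finset.card_eq_zero, Finset.filter_eq_empty_iff]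
  constructor
  · intro h a ha
    exact h ha rfl
  · rintro h ⟨a, b⟩ hab rfl
    exact h a hab

theorem indegree_le_one {F : Finset (Fin n × Fin n)} {v : Fin n} :
    indegree F v ≤ 1 ↔ ∀ a b, (a, v) ∈ F → (b, v) ∈ F → a = b := by
  unfold indegree
  rw [Finset.card_le_one]
  constructor
  · intro h a b ha hb
    exact congrArg Prod.fst (h (a, v) (by simp [ha]) (b, v) (by simp [hb]))
  · rintro h ⟨a, x⟩ ha ⟨b, y⟩ hb
    simp only [Finset.mem_filter] at ha hb
    obtain ⟨ha, rfl⟩ := ha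
    obtain ⟨hb, rfl⟩ := hb
    rw [h a b ha hb]

theorem mem_roots {F : Finset (Fin n × Fin n)} {v : Fin n} :
    v ∈ roots F ↔ ∀ a, (a, v) ∉ F := by
  simp [roots, indegree_eq_zero]

theorem Reaches.weaklyConnected {F : Finset (Fin n × Fin n)} {u v : Fin n}
    (h : Reaches F u v) : WeaklyConnected F u v := by
  induction h with
  | refl => exact .refl _
  | tail _ hbc ih => exact .trans _ _ _ ih (.rel _ _ hbc)

theorem Reaches.mono {F F' : Finset (Fin n × Fin n)} (hF : F ⊆ F') {u v : Fin n}
    (h : Reaches F u v) : Reaches F' u v :=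
  Relation.ReflTransGen.mono (fun _ _ hab => hF hab) _ _ h

/-- A working form of `IsDivergingForest`: every vertex has at most one incoming arc, and every
vertex is reached by a directed path from a root. -/
structure IsRootedForest (F : Finset (Fin n × Fin n)) : Prop where
  parent_unique : ∀ {v a b}, (a, v) ∈ F → (b, v) ∈ F → a = b
  exists_root : ∀ v, ∃ r ∈ roots F, Reaches F r v

namespace IsRootedForest

variable {F : Finset (Fin n × Fin n)}

theorem reaches_parent (hF : IsRootedForest F) {r a v : Fin n} (hr : r ∈ roots F)
    (h : Reaches F r v) (ha : (a, v) ∈ F) : Reaches F r a := by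
  rcases Relation.ReflTransGen.cases_tail h with h | ⟨c, hc, hcv⟩
  · subst h
    exact absurd ha (mem_roots.1 hr a)
  · rwa [hF.parent_unique ha hcv]

theorem root_unique (hF : IsRootedForest F) {r s v : Fin n} (hr : r ∈ roots F)
    (hs : s ∈ roots F) (hrv : Reaches F r v) (hsv : Reaches F s v) : r = s := by
  induction hrv with
  | refl =>
    rcases Relation.ReflTransGen.cases_tail hsv with h | ⟨c, -, hc⟩
    · exact h
    · exact absurd hc (mem_roots.1 hr c)
  | tail _ hbc ih => exact ih (hF.reaches_parent hs hsv hbc)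

theorem reaches_of_weaklyConnected (hF : IsRootedForest F) {r u v : Fin n} (hr : r ∈ roots F)
    (huv : WeaklyConnected F u v) : Reaches F r u ↔ Reaches F r v := by
  induction huv with
  | rel a b hab =>
    exact ⟨fun h => .tail h hab, fun h => hF.reaches_parent hr h hab⟩
  | refl => exact Iff.rfl
  | symm _ _ _ ih => exact ih.symm
  | trans _ _ _ _ _ ih₁ ih₂ => exact ih₁.trans ih₂

theorem weaklyConnected_iff_reaches (hF : IsRootedForest F) {r v : Fin n} (hr : r ∈ roots F) :
    WeaklyConnected F r v ↔ Reaches F r v :=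
  ⟨fun h => (hF.reaches_of_weaklyConnected hr h).1 .refl, Reaches.weaklyConnected⟩

/-- A diverging forest contains no directed cycle. -/
theorem not_reaches_parent (hF : IsRootedForest F) {a v : Fin n} (hav : (a, v) ∈ F) :
    ¬ Reaches F v a := by
  obtain ⟨r, hr, hrv⟩ := hF.exists_root v
  -- Following the path from the root to `v`, a cycle through a vertex is moved to its parent.
  induction hrv generalizing a with
  | refl => exact absurd hav (mem_roots.1 hr a)
  | tail _ hbc ih =>
    rename_i b c _
    obtain rfl := hF.parent_unique hav hbc
    intro h
    rcases Relation.ReflTransGen.cases_tail h with h | ⟨d, hd, hda⟩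
    · subst h
      exact ih hav .refl
    · exact ih hda (.head hav hd)

end IsRootedForest

theorem isDivergingForest_iff {F : Finset (Fin n × Fin n)} :
    IsDivergingForest F ↔ IsRootedForest F := by
  constructor
  · intro h
    have huniq : ∀ {v a b}, (a, v) ∈ F → (b, v) ∈ F → a = b := by
      intro v a b
      obtain ⟨r, -, hr0, hr1⟩ := h v
      refine indegree_le_one.1 ?_ a b
      rcases eq_or_ne v r with rfl | hv
      · omega
      · exact (hr1 v (.refl _) hv).le
    refine ⟨huniq, fun v => ?_⟩
    obtain ⟨r, hvr, hr0, -⟩ := h v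
    rw [indegree_eq_zero] at hr0
    refine ⟨r, mem_roots.2 hr0, ?_⟩
    -- The set reached from `r` is closed under predecessors too, hence it is the component.
    have key : ∀ a b, WeaklyConnected F a b → (Reaches F r a ↔ Reaches F r b) := by
      intro a b hab
      induction hab with
      | rel a b hab =>
        refine ⟨fun h => .tail h hab, fun h => ?_⟩
        rcases Relation.ReflTransGen.cases_tail h with h | ⟨c, hc, hcb⟩
        · subst h
          exact absurd hab (hr0 a)
        · rwa [huniq hab hcb]
      | refl => exact Iff.rfl
      | symm _ _ _ ih => exact ih.symm
      | trans _ _ _ _ _ ih₁ ih₂ => exact ih₁.trans ih₂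
    exact (key v r hvr).2 .refl
  · intro hF v
    obtain ⟨r, hr, hrv⟩ := hF.exists_root v
    refine ⟨r, .symm _ _ hrv.weaklyConnected, indegree_eq_zero.2 (mem_roots.1 hr), ?_⟩
    intro u hvu hur
    have hru := (hF.reaches_of_weaklyConnected hr hvu).1 hrv
    refine le_antisymm (indegree_le_one.2 fun a b => hF.parent_unique) ?_
    rw [Nat.one_le_iff_ne_zero, Ne, indegree_eq_zero]
    intro h
    rcases Relation.ReflTransGen.cases_tail hru with h' | ⟨c, -, hc⟩
    · exact hur h'
    · exact h c hc

open Classical in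
/-- The root of the tree of `F` that contains `v`; if `F` is not a diverging forest, this may be
the junk value `v`. -/
noncomputable def treeRoot (F : Finset (Fin n × Fin n)) (v : Fin n) : Fin n :=
  if h : ∃ r ∈ roots F, Reaches F r v then h.choose else v

namespace IsRootedForest

variable {F : Finset (Fin n × Fin n)}

theorem treeRoot_spec (hF : IsRootedForest F) (v : Fin n) :
    treeRoot F v ∈ roots F ∧ Reaches F (treeRoot F v) v := by
  have h := hF.exists_root v
  rw [treeRoot, dif_pos h]
  exact h.choose_spec

theorem treeRoot_eq_iff (hF : IsRootedForest F) {r v : Fin n} :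
    treeRoot F v = r ↔ r ∈ roots F ∧ Reaches F r v := by
  constructor
  · rintro rfl
    exact hF.treeRoot_spec v
  · rintro ⟨hr, hrv⟩
    exact hF.root_unique (hF.treeRoot_spec v).1 hr (hF.treeRoot_spec v).2 hrv

theorem treeRoot_of_mem_roots (hF : IsRootedForest F) {v : Fin n} (hv : v ∈ roots F) :
    treeRoot F v = v :=
  hF.treeRoot_eq_iff.2 ⟨hv, .refl⟩

theorem treeRoot_eq_iff_weaklyConnected (hF : IsRootedForest F) {r v : Fin n} :
    treeRoot F v = r ↔ r ∈ roots F ∧ WeaklyConnected F r v := by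
  rw [hF.treeRoot_eq_iff]
  exact and_congr_right fun hr => (hF.weaklyConnected_iff_reaches hr).symm

/-- Hanging the tree rooted at `j` on a vertex `l` of another tree. -/
theorem insert_arc (hF : IsRootedForest F) {j l : Fin n} (hj : j ∈ roots F)
    (hl : treeRoot F l ≠ j) :
    IsRootedForest (insert (l, j) F) ∧
      ∀ v, treeRoot (insert (l, j) F) v =
        if treeRoot F v = j then treeRoot F l else treeRoot F v := by
  have hsub : F ⊆ insert (l, j) F := Finset.subset_insert _ _
  have hroots : ∀ r ∈ roots F, r ≠ j → r ∈ roots (insert (l, j) F) := by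
    intro r hr hrj
    rw [mem_roots] at hr ⊢
    intro a ha
    rcases Finset.mem_insert.1 ha with h | h
    · exact hrj (congrArg Prod.snd h)
    · exact hr a h
  have hspec : ∀ v, (if treeRoot F v = j then treeRoot F l else treeRoot F v) ∈
      roots (insert (l, j) F) ∧ Reaches (insert (l, j) F)
        (if treeRoot F v = j then treeRoot F l else treeRoot F v) v := by
    intro v
    split_ifs with hv
    · refine ⟨hroots _ (hF.treeRoot_spec l).1 hl, ?_⟩
      have h₁ := (hF.treeRoot_spec l).2.mono hsub
      have h₂ := (hF.treeRoot_eq_iff.1 hv).2.mono hsub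
      exact (h₁.tail (Finset.mem_insert_self _ _)).trans h₂
    · exact ⟨hroots _ (hF.treeRoot_spec v).1 hv, (hF.treeRoot_spec v).2.mono hsub⟩
  have hforest : IsRootedForest (insert (l, j) F) := by
    refine ⟨?_, fun v => ⟨_, hspec v⟩⟩
    intro v a b ha hb
    rw [mem_roots] at hj
    rcases Finset.mem_insert.1 ha with h | h <;> rcases Finset.mem_insert.1 hb with h' | h'
    · rw [Prod.mk.injEq] at h h'
      rw [h.1, h'.1]
    · rw [Prod.mk.injEq] at h
      exact absurd (h.2 ▸ h') (hj b)
    · rw [Prod.mk.injEq] at h'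
      exact absurd (h'.2 ▸ h) (hj a)
    · exact hF.parent_unique h h'
  exact ⟨hforest, fun v => hforest.treeRoot_eq_iff.2 (hspec v)⟩

/-- Deleting the arc `(l, j)` cuts off a tree rooted at `j` that does not contain `l`. -/
theorem erase_arc (hF : IsRootedForest F) {j l : Fin n} (hlj : (l, j) ∈ F) :
    IsRootedForest (F.erase (l, j)) ∧ j ∈ roots (F.erase (l, j)) ∧
      treeRoot (F.erase (l, j)) l ≠ j := by
  have hsub : F.erase (l, j) ⊆ F := Finset.erase_subset _ _
  have hj : j ∈ roots (F.erase (l, j)) := by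
    rw [mem_roots]
    intro a ha
    rw [Finset.mem_erase] at ha
    exact ha.1 (by rw [hF.parent_unique ha.2 hlj])
  have hforest : IsRootedForest (F.erase (l, j)) := by
    refine ⟨fun ha hb => hF.parent_unique (hsub ha) (hsub hb), fun v => ?_⟩
    obtain ⟨r, hr, hrv⟩ := hF.exists_root v
    induction hrv with
    | refl =>
      refine ⟨r, ?_, .refl⟩
      rw [mem_roots] at hr ⊢
      exact fun a ha => hr a (hsub ha)
    | tail _ hbc ih =>
      rename_i b c _
      by_cases h : (b, c) = (l, j)
      · rw [Prod.mk.injEq] at h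
        exact ⟨j, hj, h.2 ▸ .refl⟩
      · obtain ⟨s, hs, hsb⟩ := ih
        exact ⟨s, hs, .tail hsb (Finset.mem_erase.2 ⟨h, hbc⟩)⟩
  refine ⟨hforest, hj, fun h => ?_⟩
  exact hF.not_reaches_parent hlj ((hforest.treeRoot_eq_iff.1 h).2.mono hsub)

/-- Each vertex that is not a root is the head of exactly one arc. -/
theorem card_add_card_roots (hF : IsRootedForest F) : F.card + (roots F).card = n := by
  have h₁ : F.card = ∑ v : Fin n, indegree F v :=
    Finset.card_eq_sum_card_fiberwise (f := Prod.snd) (t := Finset.univ) (fun _ _ => by simp)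
  have h₂ : (roots F).card = ∑ v : Fin n, if indegree F v = 0 then 1 else 0 := by
    rw [roots, Finset.card_filter]
  rw [h₁, h₂, ← Finset.sum_add_distrib]
  conv_rhs => rw [← Fintype.card_fin n, ← Finset.card_univ, Finset.card_eq_sum_ones]
  refine Finset.sum_congr rfl fun v _ => ?_
  have : indegree F v ≤ 1 := indegree_le_one.2 fun a b => hF.parent_unique
  split_ifs <;> omega

end IsRootedForest

theorem isRootedForest_empty : IsRootedForest (∅ : Finset (Fin n × Fin n)) :=
  ⟨fun h => by simp at h, fun v => ⟨v, by simp [mem_roots], .refl⟩⟩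

open Classical in
/-- All diverging forests on the vertex set `Fin n`. -/
noncomputable def forests (n : ℕ) : Finset (Finset (Fin n × Fin n)) :=
  Finset.univ.filter IsRootedForest

open Classical in
/-- The diverging forests on the vertex set `Fin n` in which `j` is a root. -/
noncomputable def forestsRootedAt (j : Fin n) : Finset (Finset (Fin n × Fin n)) :=
  (forests n).filter (fun F => j ∈ roots F)

theorem mem_forests {F : Finset (Fin n × Fin n)} : F ∈ forests n ↔ IsRootedForest F := by
  simp [forests]

theorem mem_forestsRootedAt {F : Finset (Fin n × Fin n)} {j : Fin n} :
    F ∈ forestsRootedAt j ↔ IsRootedForest F ∧ j ∈ roots F := by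
  simp [forestsRootedAt, mem_forests]

theorem not_mem_of_mem_roots {F : Finset (Fin n × Fin n)} {j l : Fin n} (hj : j ∈ roots F) :
    (l, j) ∉ F :=
  mem_roots.1 hj l

/-- A forest either has `j` as a root or arises in exactly one way from such a forest by hanging
the tree of `j` on a vertex `l` of another tree. -/
theorem sum_forests_eq {M : Type*} [AddCommMonoid M] (j : Fin n)
    (f : Finset (Fin n × Fin n) → M) :
    ∑ F ∈ forests n, f F = ∑ D ∈ forestsRootedAt j, f D +
      ∑ D ∈ forestsRootedAt j, ∑ l with treeRoot D l ≠ j, f (insert (l, j) D) := by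
  classical
  rw [← Finset.sum_filter_add_sum_filter_not (forests n) (fun F => j ∈ roots F) f]
  congr 1
  rw [Finset.sum_sigma']
  symm
  refine Finset.sum_bij (fun x _ => insert (x.2, j) x.1) ?_ ?_ ?_ (fun _ _ => rfl)
  · rintro ⟨D, l⟩ h
    simp only [Finset.mem_sigma, mem_forestsRootedAt, Finset.mem_filter, Finset.mem_univ,
      true_and] at h
    simp only [Finset.mem_filter, mem_forests, mem_roots]
    exact ⟨(h.1.1.insert_arc h.1.2 h.2).1, fun h' => h' l (Finset.mem_insert_self _ _)⟩
  · rintro ⟨D, l⟩ h ⟨D', l'⟩ h' heq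
    simp only [Finset.mem_sigma, mem_forestsRootedAt, Finset.mem_filter, Finset.mem_univ,
      true_and] at h h' heq
    have hl : l = l' := by
      have := heq ▸ Finset.mem_insert_self (l, j) D
      rcases Finset.mem_insert.1 this with h₀ | h₀
      · exact congrArg Prod.fst h₀
      · exact absurd h₀ (not_mem_of_mem_roots h'.1.2)
    subst hl
    have hD : D = D' := by
      rw [← Finset.erase_insert (not_mem_of_mem_roots (l := l) h.1.2), heq,
        Finset.erase_insert (not_mem_of_mem_roots h'.1.2)]
    rw [hD]
  · intro F hF
    simp only [Finset.mem_filter, mem_forests, mem_roots, not_forall, not_not] at hF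
    obtain ⟨hF, l, hl⟩ := hF
    have h := hF.erase_arc hl
    refine ⟨⟨F.erase (l, j), l⟩, ?_, Finset.insert_erase hl⟩
    simp only [Finset.mem_sigma, mem_forestsRootedAt, Finset.mem_filter, Finset.mem_univ,
      true_and]
    exact ⟨⟨h.1, h.2.1⟩, h.2.2⟩

end ArcSet

/-! ### The recurrence for the matrices of out-forests -/

namespace WeightedDigraph

variable {n : ℕ} (G : WeightedDigraph n)

open ArcSet

/-- The part of degree `k` of the weight of an arc set: its weight if it has `k` arcs, and zero
otherwise. -/
noncomputable def gradedWeight (k : ℕ) (F : Finset (Fin n × Fin n)) : ℝ :=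
  if F.card = k then G.subgraphWeight F else 0

theorem subgraphWeight_eq_zero {F : Finset (Fin n × Fin n)} (hF : ¬ F ⊆ G.arcs) :
    G.subgraphWeight F = 0 := by
  rw [Finset.not_subset] at hF
  obtain ⟨a, haF, ha⟩ := hF
  refine Finset.prod_eq_zero haF (le_antisymm ?_ (G.weight_nonneg _ _))
  simpa [arcs] using ha

theorem mem_outForestsWith {k : ℕ} {F : Finset (Fin n × Fin n)} :
    F ∈ G.outForestsWith k ↔ (F ⊆ G.arcs ∧ IsRootedForest F) ∧ F.card = k := by
  simp [outForestsWith, outForests, isDivergingForest_iff]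

/-- A sum over the out-forests of `G` extends to all diverging forests on its vertex set, since
the weight of an arc set vanishes unless all its arcs belong to `G`. -/
theorem sum_outForestsWith_mul (k : ℕ) (f : Finset (Fin n × Fin n) → ℝ) :
    ∑ F ∈ G.outForestsWith k, G.subgraphWeight F * f F =
      ∑ F ∈ forests n, G.gradedWeight k F * f F := by
  have hsub : G.outForestsWith k ⊆ forests n :=
    fun F hF => mem_forests.2 (G.mem_outForestsWith.1 hF).1.2
  rw [← Finset.sum_subset hsub]
  · refine Finset.sum_congr rfl fun F hF => ?_
    rw [gradedWeight, if_pos ((G.mem_outForestsWith.1 hF).2)]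
  · intro F hF hF'
    rw [mem_forests] at hF
    rw [mem_outForestsWith] at hF'
    unfold gradedWeight
    split_ifs with h
    · rw [G.subgraphWeight_eq_zero fun h' => hF' ⟨⟨h', hF⟩, h⟩, zero_mul]
    · rw [zero_mul]

theorem sigma_eq_sum (k : ℕ) : G.sigma k = ∑ F ∈ forests n, G.gradedWeight k F := by
  simpa [sigma] using G.sum_outForestsWith_mul k fun _ => 1

theorem forestMatrix_apply (k : ℕ) (i j : Fin n) :
    G.forestMatrix k i j =
      ∑ F ∈ forests n, G.gradedWeight k F * (if treeRoot F j = i then 1 else 0) := by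
  rw [← sum_outForestsWith_mul, forestMatrix, Matrix.of_apply, outForestsFromTo,
    Finset.sum_filter]
  refine Finset.sum_congr rfl fun F hF => ?_
  have h := (G.mem_outForestsWith.1 hF).1.2
  rw [mul_ite, mul_one, mul_zero]
  by_cases hij : treeRoot F j = i
  · rw [if_pos hij, if_pos (h.treeRoot_eq_iff_weaklyConnected.1 hij)]
  · rw [if_neg hij, if_neg fun h' => hij (h.treeRoot_eq_iff_weaklyConnected.2 h')]

theorem gradedWeight_succ_insert (k : ℕ) {D : Finset (Fin n × Fin n)} {a : Fin n × Fin n}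
    (ha : a ∉ D) :
    G.gradedWeight (k + 1) (insert a D) = G.gradedWeight k D * G.weight a.1 a.2 := by
  simp only [gradedWeight, Finset.card_insert_of_notMem ha, add_left_inj, subgraphWeight,
    Finset.prod_insert ha]
  split_ifs <;> ring

theorem gradedWeight_zero_insert {D : Finset (Fin n × Fin n)} {a : Fin n × Fin n} :
    G.gradedWeight 0 (insert a D) = 0 := by
  simp [gradedWeight]

theorem mul_laplacian_apply (A : Matrix (Fin n) (Fin n) ℝ) (i j : Fin n) :
    (A * G.laplacian) i j = ∑ l, G.weight l j * (A i j - A i l) := by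
  have hL : ∀ l, G.laplacian l j =
      (if l = j then ∑ k, G.weight k j else 0) - G.weight l j := by
    intro l
    rw [laplacian, Matrix.of_apply]
    split_ifs with h
    · subst h
      rw [G.weight_self, sub_zero]
      exact Finset.sum_erase Finset.univ (f := fun k => G.weight k l) (G.weight_self l)
    · rw [zero_sub]
  simp only [Matrix.mul_apply, hL, mul_sub, mul_ite, mul_zero, Finset.sum_sub_distrib,
    Finset.sum_ite_eq', Finset.mem_univ, if_true, ← Finset.sum_mul]
  rw [mul_comm]
  simp only [mul_comm]

/-- The contributions of the forests in which `j` is not a root cancel: such a forest arises by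
hanging the tree of `j` on `m`, and the terms are antisymmetric in `m` and the index of the
inner sum. -/
theorem sum_hang_cancel (k : ℕ) (i j : Fin n) {D : Finset (Fin n × Fin n)}
    (hD : IsRootedForest D) (hj : j ∈ roots D) :
    ∑ m with treeRoot D m ≠ j, G.gradedWeight k (insert (m, j) D) *
      (∑ l, G.weight l j * ((if treeRoot (insert (m, j) D) j = i then 1 else 0) -
        (if treeRoot (insert (m, j) D) l = i then 1 else 0))) = 0 := by
  cases k with
  | zero => simp [gradedWeight_zero_insert]
  | succ k =>
    set e : Fin n → ℝ := fun v => if treeRoot D v = i then 1 else 0 with he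
    have hterm : ∀ m ∈ (Finset.univ.filter fun m => treeRoot D m ≠ j),
        G.gradedWeight (k + 1) (insert (m, j) D) *
          (∑ l, G.weight l j * ((if treeRoot (insert (m, j) D) j = i then 1 else 0) -
            (if treeRoot (insert (m, j) D) l = i then 1 else 0))) =
        G.gradedWeight k D * ∑ l with treeRoot D l ≠ j,
          G.weight m j * G.weight l j * (e m - e l) := by
      intro m hm
      have hm' : treeRoot D m ≠ j := by simpa using hm
      rw [G.gradedWeight_succ_insert k (not_mem_of_mem_roots hj), mul_assoc, Finset.mul_sum]
      congr 1
      rw [Finset.sum_filter]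
      refine Finset.sum_congr rfl fun l _ => ?_
      rw [(hD.insert_arc hj hm').2, (hD.insert_arc hj hm').2, hD.treeRoot_of_mem_roots hj,
        if_pos rfl]
      by_cases hl : treeRoot D l = j
      -- The tree of `j` now hangs on `m`, so for `l` in it both indicators are `e m`.
      · simp [hl]
      · simp only [hl, if_false, ne_eq, not_false_eq_true, if_true, he]
        ring
    rw [Finset.sum_congr rfl hterm, ← Finset.mul_sum]
    have hanti : ∑ m with treeRoot D m ≠ j, ∑ l with treeRoot D l ≠ j,
        G.weight m j * G.weight l j * (e m - e l) =
        -∑ m with treeRoot D m ≠ j, ∑ l with treeRoot D l ≠ j,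
          G.weight m j * G.weight l j * (e m - e l) := by
      conv_lhs => rw [Finset.sum_comm]
      rw [← Finset.sum_neg_distrib]
      refine Finset.sum_congr rfl fun m _ => ?_
      rw [← Finset.sum_neg_distrib]
      exact Finset.sum_congr rfl fun l _ => by ring
    rw [self_eq_neg.1 hanti, mul_zero]

/-- The recurrence that links the matrices of out-forests with `k` and with `k + 1` arcs. -/
theorem forestMatrix_succ_add (k : ℕ) :
    G.forestMatrix (k + 1) + G.forestMatrix k * G.laplacian =
      G.sigma (k + 1) • (1 : Matrix (Fin n) (Fin n) ℝ) := by
  ext i j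
  rw [Matrix.add_apply, mul_laplacian_apply, Matrix.smul_apply, smul_eq_mul, Matrix.one_apply]
  have h₁ : ∑ l, G.weight l j * (G.forestMatrix k i j - G.forestMatrix k i l) =
      ∑ F ∈ forests n, G.gradedWeight k F *
        ∑ l, G.weight l j * ((if treeRoot F j = i then 1 else 0) -
          (if treeRoot F l = i then 1 else 0)) := by
    simp only [forestMatrix_apply, ← Finset.sum_sub_distrib, Finset.mul_sum]
    rw [Finset.sum_comm]
    exact Finset.sum_congr rfl fun F _ => Finset.sum_congr rfl fun l _ => by ring
  have h₂ : ∑ D ∈ forestsRootedAt j, ∑ m with treeRoot D m ≠ j,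
      G.gradedWeight k (insert (m, j) D) *
        (∑ l, G.weight l j * ((if treeRoot (insert (m, j) D) j = i then 1 else 0) -
          (if treeRoot (insert (m, j) D) l = i then 1 else 0))) = 0 :=
    Finset.sum_eq_zero fun D hD => by
      rw [mem_forestsRootedAt] at hD
      exact G.sum_hang_cancel k i j hD.1 hD.2
  have h₃ : G.sigma (k + 1) * (if i = j then 1 else 0) - G.forestMatrix (k + 1) i j =
      ∑ F ∈ forests n, G.gradedWeight (k + 1) F *
        ((if i = j then 1 else 0) - (if treeRoot F j = i then 1 else 0)) := by
    rw [sigma_eq_sum, forestMatrix_apply, Finset.sum_mul, ← Finset.sum_sub_distrib]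
    exact Finset.sum_congr rfl fun F _ => by ring
  refine add_eq_of_eq_sub' ?_
  symm
  rw [h₃, h₁, sum_forests_eq j, sum_forests_eq j, h₂, add_zero,
    Finset.sum_eq_zero, zero_add]
  · refine Finset.sum_congr rfl fun D hD => ?_
    rw [mem_forestsRootedAt] at hD
    obtain ⟨hD, hj⟩ := hD
    rw [Finset.mul_sum, Finset.sum_filter]
    refine Finset.sum_congr rfl fun l _ => ?_
    rw [hD.treeRoot_of_mem_roots hj]
    by_cases hl : treeRoot D l = j
    · simp [hl]
    · rw [if_pos hl, G.gradedWeight_succ_insert k (not_mem_of_mem_roots hj),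
        (hD.insert_arc hj hl).2, hD.treeRoot_of_mem_roots hj, if_pos rfl]
      simp only [eq_comm (a := i) (b := j)]
      ring
  -- A forest in which `j` is a root contributes zero to `σ (k + 1) • 1 - Q (k + 1)`.
  · intro D hD
    rw [mem_forestsRootedAt] at hD
    rw [hD.1.treeRoot_of_mem_roots hD.2]
    simp only [eq_comm (a := i) (b := j), sub_self, mul_zero]

theorem forestMatrix_zero :
    G.forestMatrix 0 = G.sigma 0 • (1 : Matrix (Fin n) (Fin n) ℝ) := by
  ext i j
  rw [forestMatrix_apply, sigma_eq_sum, Matrix.smul_apply, smul_eq_mul, Finset.sum_mul]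
  refine Finset.sum_congr rfl fun F _ => ?_
  by_cases hF : F = ∅
  · rw [hF, isRootedForest_empty.treeRoot_of_mem_roots (by simp [mem_roots]), Matrix.one_apply]
    simp only [eq_comm (a := j)]
  · rw [gradedWeight, if_neg (by simpa using hF), zero_mul, zero_mul]

/-! ### Maximum out-forests -/

/-- The case `k = 0` is needed when `G` has no arcs and its only out-forest is the empty one. -/
theorem exists_forestMatrix_add_mul_laplacian (k : ℕ) :
    ∃ M : Matrix (Fin n) (Fin n) ℝ, G.forestMatrix k + M * G.laplacian = G.sigma k • 1 := by
  cases k with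
  | zero => exact ⟨0, by rw [zero_mul, add_zero, forestMatrix_zero]⟩
  | succ k => exact ⟨_, G.forestMatrix_succ_add k⟩

theorem mem_outForests {F : Finset (Fin n × Fin n)} :
    F ∈ G.outForests ↔ F ⊆ G.arcs ∧ IsRootedForest F := by
  simp [outForests, isDivergingForest_iff]

theorem subgraphWeight_pos {F : Finset (Fin n × Fin n)} (hF : F ⊆ G.arcs) :
    0 < G.subgraphWeight F :=
  Finset.prod_pos fun a ha => by simpa [arcs] using hF ha

theorem sigma_maximum_pos : 0 < G.sigma (n - G.outForestDim) := by
  have hne : {d | ∃ F ∈ G.outForests, (roots F).card = d}.Nonempty :=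
    ⟨_, ∅, G.mem_outForests.2 ⟨Finset.empty_subset _, isRootedForest_empty⟩, rfl⟩
  obtain ⟨F, hF, hd⟩ := Nat.sInf_mem hne
  change (roots F).card = G.outForestDim at hd
  refine Finset.sum_pos (fun F hF => G.subgraphWeight_pos (G.mem_outForestsWith.1 hF).1.1) ⟨F, ?_⟩
  rw [mem_outForests] at hF
  have := hF.2.card_add_card_roots
  exact G.mem_outForestsWith.2 ⟨hF, by omega⟩

theorem outForestsWith_succ_maximum : G.outForestsWith (n - G.outForestDim + 1) = ∅ := by
  rw [Finset.eq_empty_iff_forall_notMem]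
  intro F hF
  rw [mem_outForestsWith] at hF
  have h₁ := hF.1.2.card_add_card_roots
  have h₂ : G.outForestDim ≤ (roots F).card :=
    Nat.sInf_le ⟨F, G.mem_outForests.2 hF.1, rfl⟩
  omega

theorem maxForestMatrix_mul_laplacian : G.maxForestMatrix * G.laplacian = 0 := by
  have h := G.forestMatrix_succ_add (n - G.outForestDim)
  have hσ : G.sigma (n - G.outForestDim + 1) = 0 := by
    rw [sigma, outForestsWith_succ_maximum, Finset.sum_empty]
  have hQ : G.forestMatrix (n - G.outForestDim + 1) = 0 := by
    ext i j
    simp [forestMatrix, outForestsFromTo, outForestsWith_succ_maximum]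
  rw [hσ, hQ, zero_smul, zero_add] at h
  rw [maxForestMatrix, normalizedForestMatrix, Matrix.smul_mul, h, smul_zero]

theorem exists_maxForestMatrix_add_mul_laplacian :
    ∃ M : Matrix (Fin n) (Fin n) ℝ, G.maxForestMatrix + M * G.laplacian = 1 := by
  obtain ⟨M, hM⟩ := G.exists_forestMatrix_add_mul_laplacian (n - G.outForestDim)
  refine ⟨(G.sigma (n - G.outForestDim))⁻¹ • M, ?_⟩
  rw [maxForestMatrix, normalizedForestMatrix, Matrix.smul_mul, ← smul_add, hM, smul_smul,
    inv_mul_cancel₀ G.sigma_maximum_pos.ne', one_smul]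

end WeightedDigraph

/-! ### Cesàro limits of Markov chains -/

namespace MarkovChain

variable {n : ℕ}

open Matrix

theorem stateDistribution_succ (P : Matrix (Fin n) (Fin n) ℝ) (p : Fin n → ℝ) (k : ℕ) :
    stateDistribution P p (k + 1) = stateDistribution P p k ᵥ* P := by
  rw [stateDistribution, stateDistribution, pow_succ, vecMul_vecMul]

theorem stateDistribution_mem_stdSimplex {P : Matrix (Fin n) (Fin n) ℝ}
    (hP : P ∈ rowStochastic ℝ (Fin n)) {p : Fin n → ℝ} (hp : p ∈ stdSimplex ℝ (Fin n)) (k : ℕ) :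
    stateDistribution P p k ∈ stdSimplex ℝ (Fin n) := by
  have hPk : P ^ k ∈ rowStochastic ℝ (Fin n) := pow_mem hP k
  refine ⟨fun i => nonneg_vecMul_of_mem_rowStochastic hPk hp.1 i, ?_⟩
  have h := vecMul_dotProduct_one_eq_one_rowStochastic (x := p) hPk (by
    simpa [dotProduct_one] using hp.2)
  simpa [dotProduct_one, stateDistribution] using h

theorem uniform_mem_stdSimplex (hn : n ≠ 0) : uniform n ∈ stdSimplex ℝ (Fin n) := by
  refine ⟨fun i => by unfold uniform; positivity, ?_⟩
  have : (n : ℝ) ≠ 0 := by exact_mod_cast hn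
  simp [uniform, this]

/-- If `P * A = A` and `A + (1 - P) * K = 1`, then `A` is the Cesàro limit of the powers of `P`:
the averages of `p P ^ k (1 - P) K` telescope and tend to zero. -/
theorem tendsto_average_stateDistribution {P A K : Matrix (Fin n) (Fin n) ℝ}
    (hP : P ∈ rowStochastic ℝ (Fin n)) (hPA : P * A = A) (hA : A + (1 - P) * K = 1)
    {p : Fin n → ℝ} (hp : p ∈ stdSimplex ℝ (Fin n)) :
    Tendsto (fun N : ℕ => (1 / (N : ℝ)) • ∑ k ∈ Finset.range N, stateDistribution P p k) atTop
      (𝓝 (p ᵥ* A)) := by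
  have hpow : ∀ k, P ^ k * A = A := by
    intro k
    induction k with
    | zero => rw [pow_zero, one_mul]
    | succ k ih => rw [pow_succ, mul_assoc, hPA, ih]
  have hterm : ∀ k, stateDistribution P p k =
      p ᵥ* A + (stateDistribution P p k ᵥ* K - stateDistribution P p (k + 1) ᵥ* K) := by
    intro k
    rw [← sub_vecMul, stateDistribution_succ]
    conv_lhs => rw [← vecMul_one (stateDistribution P p k), ← hA, vecMul_add, ← vecMul_vecMul,
      vecMul_sub, vecMul_one]
    congr 1
    rw [stateDistribution, vecMul_vecMul, hpow]
  have hsum : ∀ N, ∑ k ∈ Finset.range N, stateDistribution P p k =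
      (N : ℝ) • (p ᵥ* A) + (p - stateDistribution P p N) ᵥ* K := by
    intro N
    rw [Finset.sum_congr rfl fun k _ => hterm k, Finset.sum_add_distrib,
      Finset.sum_range_sub' fun k => stateDistribution P p k ᵥ* K, Finset.sum_const,
      Finset.card_range, sub_vecMul, ← Nat.cast_smul_eq_nsmul ℝ]
    simp [stateDistribution]
  have hzero : Tendsto (fun N : ℕ => (1 / (N : ℝ)) • ((p - stateDistribution P p N) ᵥ* K)) atTop
      (𝓝 0) := by
    rw [tendsto_pi_nhds]
    intro i
    refine squeeze_zero_norm (a := fun N : ℕ => (1 / (N : ℝ)) * ∑ j, |K j i|) ?_ ?_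
    · intro N
      have hq := stateDistribution_mem_stdSimplex hP hp N
      rw [Pi.smul_apply, norm_smul, Real.norm_of_nonneg (by positivity), Real.norm_eq_abs]
      gcongr
      rw [vecMul, dotProduct]
      refine (Finset.abs_sum_le_sum_abs _ _).trans (Finset.sum_le_sum fun j _ => ?_)
      rw [abs_mul]
      refine mul_le_of_le_one_left (abs_nonneg _) ?_
      have h₁ := stdSimplex_subset_Icc ℝ hp
      have h₂ := stdSimplex_subset_Icc ℝ hq
      rw [Pi.sub_apply, abs_le]
      have h₃ := h₁.1 j
      have h₄ := h₁.2 j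
      have h₅ := h₂.1 j
      have h₆ := h₂.2 j
      simp only [Pi.zero_apply, Pi.one_apply] at h₃ h₄ h₅ h₆
      constructor <;> linarith
    · simpa using (tendsto_one_div_atTop_nhds_zero_nat (𝕜 := ℝ)).mul_const (∑ j, |K j i|)
  have hlim := hzero.const_add (p ᵥ* A)
  rw [add_zero] at hlim
  refine hlim.congr' ?_
  filter_upwards [eventually_ne_atTop 0] with N hN
  have : (N : ℝ) ≠ 0 := by exact_mod_cast hN
  rw [hsum, smul_add, smul_smul, one_div_mul_cancel this, one_smul]

theorem isLimitingDistribution_of_tendsto {p : ℕ → Fin n → ℝ} {x : Fin n → ℝ}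
    (hp : ∀ k, p k ∈ stdSimplex ℝ (Fin n))
    (h : Tendsto (fun N : ℕ => (1 / (N : ℝ)) • ∑ k ∈ Finset.range N, p k) atTop (𝓝 x)) :
    IsLimitingDistribution p x := by
  refine ⟨(isClosed_stdSimplex ℝ (Fin n)).mem_of_tendsto h ?_, h⟩
  filter_upwards [eventually_ne_atTop 0] with N hN
  have : (N : ℝ) ≠ 0 := by exact_mod_cast hN
  rw [Finset.smul_sum]
  refine (convex_stdSimplex ℝ (Fin n)).sum_mem (fun _ _ => by positivity) ?_ fun k _ => hp k
  simp [this]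

/-! ### The law of a Markov chain at a fixed time -/

section Law

open MeasureTheory

variable {Ω : Type*} [MeasurableSpace Ω] {μ : Measure Ω} {P : Matrix (Fin n) (Fin n) ℝ}
  {X : ℕ → Ω → Fin n}

theorem measureReal_eq_sum_inter [IsFiniteMeasure μ] {Y : Ω → Fin n} (hY : Measurable Y)
    {A : Set Ω} (hA : MeasurableSet A) :
    μ.real A = ∑ a, μ.real (A ∩ {ω | Y ω = a}) := by
  rw [← measureReal_iUnion_fintype]
  · congr 1
    ext ω
    simp
  · intro a b hab
    rw [Function.onFun, Set.disjoint_left]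
    rintro ω ⟨-, ha⟩ ⟨-, hb⟩
    exact hab (ha.symm.trans hb)
  · exact fun a => hA.inter (hY (measurableSet_singleton a))

theorem IsChain.measurableSet_path (h : IsChain μ P X) (t k : ℕ) (s : ℕ → Fin n) :
    MeasurableSet {ω | ∀ m, t ≤ m → m ≤ k → X m ω = s m} := by
  simp only [Set.ofPred_forall]
  exact .iInter fun m => .iInter fun _ => .iInter fun _ =>
    h.measurable m (measurableSet_singleton (s m))

/-- The Markov property for a path observed from time `t` on, by summing over its earlier
states. -/
theorem IsChain.markov_from (h : IsChain μ P X) (t k : ℕ) (htk : t ≤ k) (s : ℕ → Fin n) :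
    μ.real {ω | ∀ m, t ≤ m → m ≤ k + 1 → X m ω = s m} =
      μ.real {ω | ∀ m, t ≤ m → m ≤ k → X m ω = s m} * P (s k) (s (k + 1)) := by
  have := h.isProbabilityMeasure
  induction t generalizing s with
  | zero => simpa using h.markov k s
  | succ t ih =>
    have hset : ∀ (K : ℕ), t ≤ K → ∀ a,
        {ω | ∀ m, t + 1 ≤ m → m ≤ K → X m ω = s m} ∩ {ω | X t ω = a} =
        {ω | ∀ m, t ≤ m → m ≤ K → X m ω = Function.update s t a m} := by
      intro K hK a
      ext ω
      simp only [Set.mem_inter_iff, Set.mem_ofPred_eq]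
      constructor
      · rintro ⟨h₁, h₂⟩ m hm hmK
        rcases hm.eq_or_lt with rfl | hm
        · simpa using h₂
        · rw [Function.update_of_ne hm.ne']
          exact h₁ m hm hmK
      · intro h₁
        refine ⟨fun m hm hmK => ?_, by simpa using h₁ t le_rfl hK⟩
        rw [h₁ m (by omega) hmK, Function.update_of_ne (by omega)]
    rw [measureReal_eq_sum_inter (h.measurable t) (h.measurableSet_path _ _ s),
      measureReal_eq_sum_inter (h.measurable t) (h.measurableSet_path (t + 1) k s),
      Finset.sum_mul]
    refine Finset.sum_congr rfl fun a _ => ?_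
    rw [hset _ (by omega), hset _ (by omega), ih (by omega), Function.update_of_ne (by omega),
      Function.update_of_ne (by omega)]

theorem IsChain.law_succ (h : IsChain μ P X) (k : ℕ) :
    (fun i => μ.real {ω | X (k + 1) ω = i}) = (fun i => μ.real {ω | X k ω = i}) ᵥ* P := by
  have := h.isProbabilityMeasure
  ext j
  have hmeas : MeasurableSet {ω | X (k + 1) ω = j} :=
    h.measurable (k + 1) (measurableSet_singleton j)
  rw [measureReal_eq_sum_inter (h.measurable k) hmeas, vecMul, dotProduct]
  refine Finset.sum_congr rfl fun i _ => ?_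
  have hm := h.markov_from k k le_rfl fun m => if m = k then i else j
  simp only [if_true, Nat.succ_ne_self, if_false] at hm
  convert hm using 2
  · ext ω
    constructor
    · rintro ⟨h₁, h₂⟩ m hm hmk
      split_ifs with hk
      · exact hk ▸ h₂
      · obtain rfl : m = k + 1 := by omega
        exact h₁
    · intro h'
      refine ⟨?_, ?_⟩
      · simpa using h' (k + 1) (by omega) le_rfl
      · simpa using h' k le_rfl (by omega)
  · congr 1
    ext ω
    constructor
    · intro h₂ m hm hmk
      obtain rfl : m = k := by omega
      simpa using h₂
    · intro h'
      simpa using h' k le_rfl le_rfl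

theorem IsChain.law_eq_stateDistribution (h : IsChain μ P X) {p : Fin n → ℝ}
    (h₀ : ∀ i, μ.real {ω | X 0 ω = i} = p i) (k : ℕ) :
    (fun i => μ.real {ω | X k ω = i}) = stateDistribution P p k := by
  induction k with
  | zero =>
    rw [stateDistribution, pow_zero, vecMul_one]
    exact funext h₀
  | succ k ih => rw [h.law_succ, ih, stateDistribution_succ]

end Law

end MarkovChain

/-! ### The limiting distribution and the maximum out-forests -/

theorem mainTheorem10 {n : ℕ} (hn : 1 < n) (G : WeightedDigraph n)
    (P : Matrix (Fin n) (Fin n) ℝ) (hP : P ∈ Matrix.rowStochastic ℝ (Fin n))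
    (hGP : G.InverselyCorresponds P) :
    MarkovChain.IsLimitingDistribution
      (MarkovChain.stateDistribution P (MarkovChain.uniform n))
      ((1 / (n : ℝ)) • G.maxForestMatrix.mulVec (fun _ => 1)) ∧
    ∀ (Ω : Type*) [MeasurableSpace Ω] (μ : MeasureTheory.Measure Ω) (X : ℕ → Ω → Fin n),
      MarkovChain.IsChain μ P X →
      (∀ i, μ.real {ω | X 0 ω = i} = MarkovChain.uniform n i) →
      MarkovChain.IsLimitingDistribution
        (fun k i => μ.real {ω | X k ω = i})
        ((1 / (n : ℝ)) • G.maxForestMatrix.mulVec (fun _ => 1)) := by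
  obtain ⟨α, hα, hPα⟩ := hGP
  obtain ⟨M, hM⟩ := G.exists_maxForestMatrix_add_mul_laplacian
  have hu := MarkovChain.uniform_mem_stdSimplex (n := n) (by omega)
  have hfix : P * G.maxForestMatrix.transpose = G.maxForestMatrix.transpose := by
    have h : (1 - P) * G.maxForestMatrix.transpose = 0 := by
      rw [hPα, Matrix.smul_mul, ← Matrix.transpose_mul, G.maxForestMatrix_mul_laplacian,
        Matrix.transpose_zero, smul_zero]
    rw [sub_mul, one_mul, sub_eq_zero] at h
    exact h.symm
  have hres : G.maxForestMatrix.transpose + (1 - P) * (α⁻¹ • M.transpose) = 1 := by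
    rw [hPα, Matrix.smul_mul, Matrix.mul_smul, smul_smul, mul_inv_cancel₀ hα, one_smul,
      ← Matrix.transpose_mul, ← Matrix.transpose_add, hM, Matrix.transpose_one]
  have hlim := MarkovChain.tendsto_average_stateDistribution hP hfix hres hu
  have hx : Matrix.vecMul (MarkovChain.uniform n) G.maxForestMatrix.transpose =
      (1 / (n : ℝ)) • G.maxForestMatrix.mulVec (fun _ => 1) := by
    rw [Matrix.vecMul_transpose, ← Matrix.mulVec_smul]
    congr 1
    ext i
    simp [MarkovChain.uniform]
  rw [hx] at hlim
  have hmain := MarkovChain.isLimitingDistribution_of_tendsto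
    (MarkovChain.stateDistribution_mem_stdSimplex hP hu) hlim
  refine ⟨hmain, fun Ω _ μ X hX h₀ => ?_⟩
  rwa [funext (hX.law_eq_stateDistribution h₀)]
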